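/- Let $G$ be a finitely generated nilpotent group that is torsion-free, i.e. $g^n\neq e$ for every $g\in G\setminus\{e\}$ and every integer $n\ge 1$. Then $G$ is square absolutely continuous. That is, there exist two left Følner sequences $\Phi=(\Phi_N)_{N\in\mathbb{N}}$ and $\Psi=(\Psi_N)_{N\in\mathbb{N}}$ in $G$ such that for every $\epsilon>0$ there exists $\delta>0$ with the following property: for every function $u:G\to[0,1]$ satisfying $$\limsup_{N\to\infty}\frac{1}{|\Phi_N|}\sum_{g\in\Phi_N}u(g)<\delta,$$ we have $$\limsup_{N\to\infty}\frac{1}{|\Psi_N|}\sum_{g\in\Psi_N}u(g^2)<\epsilon.$$ Here a left Følner sequence in $G$ is a sequence $(\Phi_N)_{N\in\mathbb{N}}$ of nonempty finite subsets of $G$ such that $\lim_{N\to\infty}|g\Phi_N\cap\Phi_N|/|\Phi_N|=1$ for every $g\in G$. -/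

import Mathlib

open Filter Topology
open scoped Pointwise

/-- A sequence `Φ` of (nonempty) finite subsets of a group `G` is a left Følner sequence if
`|g Φ_N ∩ Φ_N| / |Φ_N| → 1` for every `g ∈ G`. -/
structure IsLeftFolnerSequence {G : Type*} [Group G] (Φ : ℕ → Finset G) : Prop where
  nonempty : ∀ N, (Φ N).Nonempty
  tendsto : ∀ g : G, Tendsto
    (fun N : ℕ => (((g • (Φ N : Set G)) ∩ (Φ N : Set G)).ncard : ℝ) / ((Φ N).card : ℝ))
    atTop (𝓝 1)

/-- The upper average `limsup_N (1/|Φ_N|) ∑_{g ∈ Φ_N} u g`. It is only used below for functions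
with values in `[0,1]`, for which all the averages lie in `[0,1]`. -/
noncomputable def upperAverage {G : Type*} (Φ : ℕ → Finset G) (u : G → ℝ) : ℝ :=
  limsup (fun N : ℕ => (1 / ((Φ N).card : ℝ)) * ∑ g ∈ Φ N, u g) atTop

/-- `G` is `φ`-absolutely continuous: there are left Følner sequences `Φ`, `Ψ` such that for every
`ε > 0` there is `δ > 0` such that, for every `u : G → [0,1]`, if the upper average of `u` along
`Φ` is less than `δ` then the upper average of `u ∘ φ` along `Ψ` is less than `ε`.
Amenability of `G`, that is, the existence of a left Følner sequence, is part of this. -/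
def IsAbsolutelyContinuousGroup (G : Type*) [Group G] (φ : G → G) : Prop :=
  ∃ Φ Ψ : ℕ → Finset G, IsLeftFolnerSequence Φ ∧ IsLeftFolnerSequence Ψ ∧
    ∀ ε : ℝ, 0 < ε → ∃ δ : ℝ, 0 < δ ∧
      ∀ u : G → ℝ, (∀ g, u g ∈ Set.Icc (0 : ℝ) 1) →
        upperAverage Φ u < δ → upperAverage Ψ (fun g => u (φ g)) < ε

/-- `G` is square absolutely continuous: it is `φ`-absolutely continuous for the squaring map
`φ g = g ^ 2`. -/
def IsSquareAbsolutelyContinuous (G : Type*) [Group G] : Prop :=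
  IsAbsolutelyContinuousGroup G (fun g => g ^ 2)

/-- `G` is torsion-free: no nontrivial element has finite order. -/
def IsTorsionFreeGroup (G : Type*) [Group G] : Prop :=
  ∀ g : G, g ≠ 1 → ∀ n : ℕ, 0 < n → g ^ n ≠ 1

/-! Let `S` be a finite generating set containing 1. Squaring is injective on a torsion-free
nilpotent group and maps `S ^ n` into `S ^ (2 * n)`. So if `2 * n ≤ m` and `|S ^ m| ≤ C |S ^ n|`,
the average of `u (g ^ 2)` over `S ^ n` is at most `C` times the average of `u` over `S ^ m`.
Polynomial growth (`exists_card_pow_le`) supplies such scales with `C` fixed and with both powers of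
`S` almost invariant (`exists_scales`); these powers are the two Følner sequences. -/

open scoped commutatorElement

/-! ### Uniqueness of square roots -/

section UniqueSquareRoots

variable {G : Type*} [Group G]

/-- The factors of the upper central series inherit the absence of 2-torsion: the commutator
identity in `h2` passes the hypothesis from `x` to `⁅x, y⁆`, one level down. -/
theorem mem_upperCentralSeries_of_sq_mem (hG : IsTorsionFreeGroup G) (i : ℕ) :
    ∀ x ∈ Subgroup.upperCentralSeries G (i + 1), x ^ 2 ∈ Subgroup.upperCentralSeries G i →
      x ∈ Subgroup.upperCentralSeries G i := by
  induction i with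
  | zero =>
    intro x _ hx
    rw [Subgroup.upperCentralSeries_zero, Subgroup.mem_bot] at hx ⊢
    by_contra h
    exact hG x h 2 two_pos hx
  | succ i ih =>
    intro x hx hx2
    rw [Subgroup.mem_upperCentralSeries_succ_iff] at hx hx2 ⊢
    intro y
    refine ih _ (hx y) ?_
    have h1 := Subgroup.mem_upperCentralSeries_succ_iff.1 (hx y) x
    have h2 : ⁅x, y⁆ ^ 2 = ⁅⁅x, y⁆, x⁆ * ⁅x ^ 2, y⁆ := by
      simp only [commutatorElement_def, pow_two]
      group
    rw [h2]
    exact mul_mem h1 (hx2 y)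

/-- Square roots are unique in a torsion-free nilpotent group. -/
theorem sq_injective_of_torsionFree_nilpotent [Group.IsNilpotent G]
    (hG : IsTorsionFreeGroup G) : Function.Injective (fun g : G => g ^ 2) := by
  intro a b hab
  have hab : a ^ 2 = b ^ 2 := hab
  -- Descent: modulo the `i`-th term `a⁻¹ * b` is central, so its square is `a⁻² * b ^ 2 = 1` there.
  have key : ∀ i, a⁻¹ * b ∈ Subgroup.upperCentralSeries G i → a⁻¹ * b = 1 := by
    intro i
    induction i with
    | zero => intro h; simpa using h
    | succ i ih =>
      intro h
      refine ih (mem_upperCentralSeries_of_sq_mem hG i _ h ?_)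
      have h1 := Subgroup.mem_upperCentralSeries_succ_iff.1 h a⁻¹
      have h2 : (a⁻¹ * b) ^ 2 = ⁅a⁻¹ * b, a⁻¹⁆ * (a⁻¹ * a⁻¹ * b ^ 2) := by
        simp only [commutatorElement_def, pow_two]
        group
      have h3 : a⁻¹ * a⁻¹ * b ^ 2 = 1 := by
        rw [← hab, pow_two]
        group
      rwa [h2, h3, mul_one]
  obtain ⟨n, hn⟩ := Group.IsNilpotent.nilpotent G
  have := key n (by rw [hn]; trivial)
  exact (inv_mul_eq_one.1 this)

end UniqueSquareRoots

/-! ### Polynomial growth of nilpotent groups -/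

section PolynomialGrowth

variable {G : Type*} [Group G] [DecidableEq G]

theorem list_prod_mem_finset_pow {S : Finset G} (l : List G) (hl : ∀ s ∈ l, s ∈ S) :
    l.prod ∈ S ^ l.length := by
  induction l with
  | nil => simp
  | cons a l ih =>
    rw [List.prod_cons, List.length_cons, pow_succ']
    exact Finset.mul_mem_mul (hl a (by simp)) (ih fun s hs => hl s (by simp [hs]))

theorem exists_list_of_mem_finset_pow {S : Finset G} (n : ℕ) :
    ∀ g ∈ S ^ n, ∃ l : List G, (∀ s ∈ l, s ∈ S) ∧ l.length = n ∧ l.prod = g := by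
  induction n with
  | zero => intro g hg; exact ⟨[], by simp, rfl, by simpa [eq_comm] using hg⟩
  | succ n ih =>
    intro g hg
    rw [pow_succ'] at hg
    obtain ⟨a, ha, h, hh, rfl⟩ := Finset.mem_mul.1 hg
    obtain ⟨l, hl, hn, rfl⟩ := ih h hh
    refine ⟨a :: l, ?_, by simp [hn], by simp⟩
    intro s hs
    rcases List.mem_cons.1 hs with rfl | hs
    exacts [ha, hl s hs]

variable {Γ : ℕ → Subgroup G} {c : ℕ}

/-- Conjugating an element of a finite set `X` by a word of length `m` yields a product of
polynomially many (in `m`) elements of a fixed finite set, in a nilpotent group. -/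
theorem exists_conj_mem_pow (hΓ : ∀ i, ∀ x ∈ Γ i, ∀ g, ⁅x, g⁆ ∈ Γ (i + 1))
    (hanti : ∀ i, Γ (i + 1) ≤ Γ i) (hc : Γ c = ⊥) (S : Finset G) (k : ℕ) : ∀ i, i + k = c → ∀ X : Finset G, (∀ x ∈ X, x ∈ Γ i) →
      ∃ Y : Finset G, (∀ y ∈ Y, y ∈ Γ i) ∧ 1 ∈ Y ∧ ∃ p : ℕ, ∀ v : List G, (∀ s ∈ v, s ∈ S) →
        ∀ x ∈ X, v.prod⁻¹ * x * v.prod ∈ Y ^ ((v.length + 1) ^ p) := by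
  induction k with
  | zero =>
    intro i hi X hX
    refine ⟨{1}, by simp [one_mem], by simp, 0, fun v _ x hx => ?_⟩
    have h := hX x hx
    rw [show i = c from hi, hc, Subgroup.mem_bot] at h
    simp [h]
  | succ k ih =>
    intro i hi X hX
    obtain ⟨Y, hY, hY1, p, hp⟩ := ih (i + 1) (by omega)
      ((X ×ˢ S).image fun q => ⁅q.1⁻¹, q.2⁻¹⁆) (by
        intro x hx
        obtain ⟨q, hq, rfl⟩ := Finset.mem_image.1 hx
        exact hΓ i _ (inv_mem (hX _ (Finset.mem_product.1 hq).1)) _)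
    refine ⟨X ∪ Y, ?_, by simp [hY1], p + 1, fun v hv x hx => ?_⟩
    · intro y hy
      rcases Finset.mem_union.1 hy with hy | hy
      exacts [hX y hy, hanti i (hY y hy)]
    have h1 : (1 : G) ∈ X ∪ Y := by simp [hY1]
    -- The bound `n` is decoupled from the length so that each added letter costs the same `(n + 1)
    -- ^ p`: it contributes a conjugated commutator, which lies one level deeper.
    have key : ∀ n : ℕ, ∀ v : List G, (∀ s ∈ v, s ∈ S) → v.length ≤ n →
        v.prod⁻¹ * x * v.prod ∈ (X ∪ Y) ^ (1 + v.length * (n + 1) ^ p) := by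
      intro n v
      induction v with
      | nil => intro _ _; simp [hx]
      | cons s v ihv =>
        intro hv hn
        have hvS : ∀ s ∈ v, s ∈ S := fun t ht => hv t (by simp [ht])
        have hn' : v.length ≤ n := by simp at hn; omega
        have e : (s :: v).prod⁻¹ * x * (s :: v).prod =
            (v.prod⁻¹ * x * v.prod) * (v.prod⁻¹ * ⁅x⁻¹, s⁻¹⁆ * v.prod) := by
          simp only [commutatorElement_def, List.prod_cons]
          group
        have e' : 1 + (s :: v).length * (n + 1) ^ p =
            (1 + v.length * (n + 1) ^ p) + (n + 1) ^ p := by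
          simp only [List.length_cons]; ring
        rw [e, e', pow_add _ _ ((n + 1) ^ p)]
        refine Finset.mul_mem_mul (ihv hvS hn') ?_
        refine Finset.pow_subset_pow Finset.subset_union_right h1
          (Nat.pow_le_pow_left (Nat.succ_le_succ hn') p) (hp v hvS _ ?_)
        exact Finset.mem_image.2 ⟨(x, s), by simp [hx, hv], rfl⟩
    refine Finset.pow_subset_pow_right h1 ?_ (key v.length v hv le_rfl)
    have : 1 ≤ (v.length + 1) ^ p := Nat.one_le_pow _ _ (by omega)
    rw [pow_succ]
    nlinarith

/-- Moving a letter to the front of a word, at the cost of polynomially many correction factors. -/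
theorem prod_mul_mul_eq_mul_prod_mul_mul {S Y : Finset G} {n K : ℕ}
    (hY : ∀ v : List G, (∀ s ∈ v, s ∈ S) → v.length ≤ n → ∀ a ∈ S, ∀ s ∈ S,
      v.prod⁻¹ * ⁅a⁻¹, s⁻¹⁆ * v.prod ∈ Y ^ K) {s : G} (hs : s ∈ S) (q : List G)
    (hq : ∀ t ∈ q, t ∈ S) (l : List G) (hl : ∀ t ∈ l, t ∈ S) (hn : l.length + q.length ≤ n) :
    ∃ r ∈ Y ^ (l.length * K), l.prod * s * q.prod = s * l.prod * q.prod * r := by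
  induction l with
  | nil => exact ⟨1, by simp, by simp⟩
  | cons a l ih =>
    have hl' : ∀ t ∈ l, t ∈ S := fun t ht => hl t (by simp [ht])
    have hn' : l.length + q.length ≤ n := by simp at hn; omega
    obtain ⟨r, hr, e⟩ := ih hl' hn'
    refine ⟨((l ++ q).prod⁻¹ * ⁅a⁻¹, s⁻¹⁆ * (l ++ q).prod) * r, ?_, ?_⟩
    · rw [List.length_cons, Nat.succ_mul, add_comm, pow_add]
      refine Finset.mul_mem_mul (hY _ ?_ (by simpa using hn') a (hl a (by simp)) s hs) hr
      intro t ht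
      rcases List.mem_append.1 ht with ht | ht
      exacts [hl' t ht, hq t ht]
    · calc (a :: l).prod * s * q.prod = a * (l.prod * s * q.prod) := by
            simp only [List.prod_cons, mul_assoc]
        _ = _ := by
            rw [e]
            simp only [commutatorElement_def, List.prod_cons, List.prod_append]
            group

/-- Permuting the letters of a word, at the cost of polynomially many correction factors. -/
theorem prod_eq_prod_mul_of_perm {S Y : Finset G} {n K : ℕ} (hY1 : 1 ∈ Y)
    (hY : ∀ v : List G, (∀ s ∈ v, s ∈ S) → v.length ≤ n → ∀ a ∈ S, ∀ s ∈ S,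
      v.prod⁻¹ * ⁅a⁻¹, s⁻¹⁆ * v.prod ∈ Y ^ K) (l' : List G) :
    ∀ l : List G, l.Perm l' → (∀ t ∈ l, t ∈ S) → l.length ≤ n →
      ∃ r ∈ Y ^ (l.length * (n * K)), l.prod = l'.prod * r := by
  induction l' with
  | nil =>
    intro l h _ _
    rw [List.perm_nil.1 h]
    exact ⟨1, by simp, by simp⟩
  | cons s t ih =>
    intro l h hl hn
    obtain ⟨l₁, l₂, rfl⟩ := List.append_of_mem (h.symm.subset List.mem_cons_self)
    have hp : (l₁ ++ l₂).Perm t := (List.perm_cons s).1 (List.perm_middle.symm.trans h)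
    have hlen : (l₁ ++ s :: l₂).length = (l₁ ++ l₂).length + 1 := by simp; omega
    have h12 : ∀ u ∈ l₁ ++ l₂, u ∈ S := by
      intro u hu
      refine hl u ?_
      simp only [List.mem_append, List.mem_cons] at hu ⊢
      tauto
    obtain ⟨r, hr, e⟩ := ih (l₁ ++ l₂) hp h12 (by omega)
    obtain ⟨r', hr', e'⟩ := prod_mul_mul_eq_mul_prod_mul_mul hY (hl s (by simp)) l₂
      (fun u hu => h12 u (by simp [hu])) l₁ (fun u hu => h12 u (by simp [hu]))
      (by simp at hlen hn ⊢; omega)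
    refine ⟨r * r', ?_, ?_⟩
    · rw [hlen, Nat.succ_mul, pow_add]
      refine Finset.mul_mem_mul hr (Finset.pow_subset_pow_right hY1 ?_ hr')
      exact Nat.mul_le_mul_right K (by simp at hn; omega)
    · rw [List.prod_append, List.prod_cons, ← mul_assoc, e', List.prod_cons, mul_assoc s,
        ← List.prod_append, e]
      simp only [mul_assoc]

/-- Finite subsets of a nilpotent group have polynomial growth. -/
theorem exists_card_pow_le (hΓ : ∀ i, ∀ x ∈ Γ i, ∀ g, ⁅x, g⁆ ∈ Γ (i + 1))
    (hanti : ∀ i, Γ (i + 1) ≤ Γ i) (hc : Γ c = ⊥) (k : ℕ) : ∀ i, i + k = c →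
      ∀ S : Finset G, (∀ x ∈ S, x ∈ Γ i) → ∃ d : ℕ, ∀ n : ℕ, (S ^ n).card ≤ (n + 1) ^ d := by
  induction k with
  | zero =>
    intro i hi S hS
    refine ⟨0, fun n => ?_⟩
    have hS1 : S ⊆ 1 := by
      intro x hx
      have h := hS x hx
      rw [show i = c from hi, hc, Subgroup.mem_bot] at h
      simp [h]
    calc (S ^ n).card ≤ ((1 : Finset G) ^ n).card :=
          Finset.card_le_card (Finset.pow_subset_pow_left hS1)
      _ = (n + 1) ^ 0 := by simp
  | succ k ih =>
    intro i hi S hS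
    obtain ⟨Y, hYΓ, hY1, p, hY⟩ := exists_conj_mem_pow hΓ hanti hc S k (i + 1) (by omega)
      ((S ×ˢ S).image fun q => ⁅q.1⁻¹, q.2⁻¹⁆) (by
        intro x hx
        obtain ⟨q, hq, rfl⟩ := Finset.mem_image.1 hx
        exact hΓ i _ (inv_mem (hS _ (Finset.mem_product.1 hq).1)) _)
    obtain ⟨d, hd⟩ := ih (i + 1) (by omega) Y hYΓ
    refine ⟨S.card + (p + 2) * d, fun n => ?_⟩
    have hYn : ∀ v : List G, (∀ s ∈ v, s ∈ S) → v.length ≤ n → ∀ a ∈ S, ∀ s ∈ S,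
        v.prod⁻¹ * ⁅a⁻¹, s⁻¹⁆ * v.prod ∈ Y ^ ((n + 1) ^ p) := by
      intro v hv hn a ha s hs
      refine Finset.pow_subset_pow_right hY1 (Nat.pow_le_pow_left (Nat.succ_le_succ hn) p)
        (hY v hv _ ?_)
      exact Finset.mem_image.2 ⟨(a, s), by simp [ha, hs], rfl⟩
    choose! L hLS hLn hLg using exists_list_of_mem_finset_pow (S := S) n
    -- An element is determined by the letter counts of a chosen word and the error made in sorting
    -- that word. The error lies in a polynomially large power of `Y`, one level deeper in the
    -- series.
    let f : G → (S → ℕ) × G := fun g =>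
      (fun s => (L g).count (s : G), ((L g : Multiset G).toList.prod)⁻¹ * g)
    have hf : Set.MapsTo f (S ^ n : Finset G)
        ((Fintype.piFinset fun _ : S => Finset.range (n + 1)) ×ˢ
          (Y ^ (n * (n * (n + 1) ^ p))) : Finset ((S → ℕ) × G)) := by
      intro g hg
      have hg : g ∈ S ^ n := hg
      refine Finset.mem_coe.2 (Finset.mem_product.2 ⟨?_, ?_⟩)
      · refine Fintype.mem_piFinset.2 fun s => Finset.mem_range_succ_iff.2 ?_
        exact List.count_le_length.trans (hLn g hg).le
      · obtain ⟨r, hr, e⟩ := prod_eq_prod_mul_of_perm hY1 hYn (L g : Multiset G).toList (L g)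
          (Multiset.coe_eq_coe.1 (Multiset.coe_toList _).symm) (hLS g hg) (hLn g hg).le
        rw [hLn g hg] at hr
        rw [hLg g hg] at e
        change ((L g : Multiset G).toList.prod)⁻¹ * g ∈ _
        rwa [inv_mul_eq_iff_eq_mul.2 e]
    have hinj : Set.InjOn f (S ^ n : Finset G) := by
      intro g hg h hh hgh
      have hg : g ∈ S ^ n := hg
      have hh : h ∈ S ^ n := hh
      have h1 : (L g : Multiset G) = L h := by
        ext s
        by_cases hs : s ∈ S
        · simpa [f] using congrFun (congrArg Prod.fst hgh) ⟨s, hs⟩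
        · rw [Multiset.count_eq_zero_of_notMem fun h' => hs (hLS g hg s h'),
            Multiset.count_eq_zero_of_notMem fun h' => hs (hLS h hh s h')]
      have h2 : ((L g : Multiset G).toList.prod)⁻¹ * g = ((L h : Multiset G).toList.prod)⁻¹ * h :=
        congrArg Prod.snd hgh
      rw [h1] at h2
      exact mul_left_cancel h2
    have hcard := Finset.card_le_card_of_injOn f hf hinj
    rw [Finset.card_product, Fintype.card_piFinset, Finset.prod_const,
      Finset.card_range, Finset.card_univ, Fintype.card_coe] at hcard
    refine hcard.trans ?_
    rw [pow_add, pow_mul (n + 1)]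
    refine Nat.mul_le_mul_left _ ((hd _).trans (Nat.pow_le_pow_left ?_ d))
    have : 1 ≤ (n + 1) ^ p := Nat.one_le_pow _ _ (by omega)
    rw [pow_add]
    nlinarith

theorem exists_card_pow_le_of_isNilpotent [Group.IsNilpotent G] (S : Finset G) :
    ∃ d : ℕ, ∀ n : ℕ, (S ^ n).card ≤ (n + 1) ^ d := by
  obtain ⟨c, hc⟩ := Subgroup.nilpotent_iff_lowerCentralSeries.1 ‹Group.IsNilpotent G›
  exact exists_card_pow_le (Γ := (⊤ : Subgroup G).lowerCentralSeries)
    (fun i x hx g => Subgroup.lowerCentralSeries_isDescendingCentralSeries.2 x i hx g)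
    (fun i => Subgroup.lowerCentralSeries_antitone _ (Nat.le_succ i)) hc c 0 (zero_add c) S
    (fun x _ => Subgroup.mem_top x)

end PolynomialGrowth

/-! ### Choice of scales -/

section Scales

/-- Otherwise iterating from `K` forces growth of degree `d + 1` along `5 ^ j * K`. -/
theorem exists_le_mul_of_polynomial_growth {b : ℕ → ℕ} {d : ℕ} (hb1 : ∀ n, 0 < b n)
    (hb : ∀ n, b n ≤ (n + 1) ^ d) (K : ℕ) :
    ∃ k, K ≤ k ∧ b (5 * k) ≤ 5 ^ (d + 1) * b k := by
  by_contra! h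
  have key : ∀ j, 5 ^ ((d + 1) * j) ≤ b (5 ^ j * K) := by
    intro j
    induction j with
    | zero => simpa [Nat.one_le_iff_ne_zero] using (hb1 K).ne'
    | succ j ih =>
      have h1 := h (5 ^ j * K) (Nat.le_mul_of_pos_left K (by positivity))
      rw [show 5 ^ (j + 1) * K = 5 * (5 ^ j * K) by ring]
      refine le_trans ?_ h1.le
      rw [Nat.mul_succ, pow_add, mul_comm]
      exact Nat.mul_le_mul_left _ ih
  set j := (K + 1) ^ d
  have h1 : 5 ^ ((d + 1) * j) ≤ (5 ^ j) ^ d * (K + 1) ^ d := by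
    rw [← mul_pow]
    refine (key j).trans ((hb _).trans (Nat.pow_le_pow_left ?_ d))
    have : 1 ≤ 5 ^ j := Nat.one_le_pow _ _ (by norm_num)
    nlinarith
  have h2 : 5 ^ ((d + 1) * j) = (5 ^ j) ^ d * 5 ^ j := by
    rw [← pow_mul, ← pow_add]; ring_nf
  rw [h2] at h1
  exact absurd (Nat.le_of_mul_le_mul_left h1 (by positivity)) (not_le.2 (Nat.lt_pow_self (by norm_num)))

theorem exists_succ_le_mul_of_le {f : ℕ → ℝ} {k₀ k : ℕ} {C ε : ℝ} (hε : 0 ≤ ε) (h0 : 0 < f k₀)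
    (hk : C < (1 + ε) ^ k) (hf : f (k₀ + k) ≤ C * f k₀) :
    ∃ n, k₀ ≤ n ∧ n < k₀ + k ∧ f (n + 1) ≤ (1 + ε) * f n := by
  by_contra! h
  have key : ∀ j ≤ k, (1 + ε) ^ j * f k₀ ≤ f (k₀ + j) := by
    intro j
    induction j with
    | zero => simp
    | succ j ih =>
      intro hj
      rw [pow_succ', mul_assoc]
      exact (mul_le_mul_of_nonneg_left (ih (by omega)) (by linarith)).trans
        (h (k₀ + j) (by omega) (by omega)).le
  have := (key k le_rfl).trans hf
  exact absurd (le_of_mul_le_mul_right this h0) (not_le.2 hk)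

/-- Take `n` in `[k, 2k)` and `m` in `[4k, 5k)`, where `b (5 * k) ≤ 5 ^ (d + 1) * b k`. Each window
is long enough to contain a step of ratio at most `1 + ε`, and the final constant does not depend on
`ε`. -/
theorem exists_scales {b : ℕ → ℕ} {d : ℕ} (hmono : Monotone b) (hb1 : ∀ n, 0 < b n)
    (hb : ∀ n, b n ≤ (n + 1) ^ d) {ε : ℝ} (hε : 0 < ε) :
    ∃ n m, 2 * n ≤ m ∧ (b (n + 1) : ℝ) ≤ (1 + ε) * b n ∧ (b (m + 1) : ℝ) ≤ (1 + ε) * b m ∧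
      (b m : ℝ) ≤ 5 ^ (d + 1) * b n := by
  obtain ⟨K, hK⟩ := pow_unbounded_of_one_lt ((5 : ℝ) ^ (d + 1)) (by linarith : 1 < 1 + ε)
  obtain ⟨k, hk, hbk⟩ := exists_le_mul_of_polynomial_growth hb1 hb K
  have hbk' : (b (5 * k) : ℝ) ≤ 5 ^ (d + 1) * b k := by exact_mod_cast hbk
  have hC : (5 : ℝ) ^ (d + 1) < (1 + ε) ^ k :=
    hK.trans_le (pow_le_pow_right₀ (by linarith) hk)
  have hm : ∀ {i j : ℕ}, i ≤ j → (b i : ℝ) ≤ b j := fun h => by exact_mod_cast hmono h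
  have hpos : ∀ i, (0 : ℝ) < b i := fun i => by exact_mod_cast hb1 i
  obtain ⟨n, hn1, hn2, hn⟩ := exists_succ_le_mul_of_le (f := fun i => (b i : ℝ)) hε.le (hpos k) hC
    ((hm (by omega)).trans hbk')
  obtain ⟨m, hm1, hm2, hm'⟩ := exists_succ_le_mul_of_le (f := fun i => (b i : ℝ)) (k₀ := 4 * k)
    hε.le (hpos _) hC ((hm (by omega)).trans (hbk'.trans
      (mul_le_mul_of_nonneg_left (hm (by omega)) (by positivity))))
  refine ⟨n, m, by omega, hn, hm', (hm (by omega)).trans (hbk'.trans ?_)⟩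
  exact mul_le_mul_of_nonneg_left (hm hn1) (by positivity)

end Scales

/-! ### Powers of a generating set as Følner sets -/

section Folner

variable {G : Type*} [Group G] [DecidableEq G]

/-- Each of the `r` letters of `g` pushes at most `|S ^ (n + 1) \ S ^ n|` new points out. -/
theorem card_smul_pow_sdiff_le {S : Finset G} (hS : 1 ∈ S) (n r : ℕ) :
    ∀ g ∈ S ^ r, (g • S ^ n \ S ^ n).card ≤ r * ((S ^ (n + 1)).card - (S ^ n).card) := by
  induction r with
  | zero =>
    intro g hg
    have : g = 1 := by simpa using hg
    simp [this]
  | succ r ih =>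
    intro g hg
    rw [pow_succ'] at hg
    obtain ⟨s, hs, h, hh, rfl⟩ := Finset.mem_mul.1 hg
    have hsub : (s * h) • S ^ n \ S ^ n ⊆
        s • (h • S ^ n \ S ^ n) ∪ (S ^ (n + 1) \ S ^ n) := by
      intro x hx
      obtain ⟨hx1, hx2⟩ := Finset.mem_sdiff.1 hx
      obtain ⟨y, hy, rfl⟩ := Finset.mem_smul_finset.1 hx1
      by_cases hy' : h • y ∈ S ^ n
      · refine Finset.mem_union_right _ (Finset.mem_sdiff.2 ⟨?_, hx2⟩)
        rw [pow_succ', mul_smul]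
        exact Finset.mul_mem_mul hs hy'
      · refine Finset.mem_union_left _ ?_
        rw [mul_smul]
        exact Finset.smul_mem_smul_finset
          (Finset.mem_sdiff.2 ⟨Finset.smul_mem_smul_finset hy, hy'⟩)
    have hd : (S ^ (n + 1) \ S ^ n).card = (S ^ (n + 1)).card - (S ^ n).card :=
      Finset.card_sdiff_of_subset (Finset.pow_subset_pow_right hS n.le_succ)
    calc _ ≤ _ := Finset.card_le_card hsub
      _ ≤ _ := Finset.card_union_le _ _
      _ ≤ _ := by
        rw [Finset.card_smul_finset, hd, Nat.succ_mul]
        exact Nat.add_le_add_right (ih h hh) _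

theorem isLeftFolnerSequence_pow {S : Finset G} (hS : 1 ∈ S)
    (hgen : ∀ g : G, ∃ r, g ∈ S ^ r) {n : ℕ → ℕ} {ε : ℕ → ℝ} (hε : Tendsto ε atTop (𝓝 0))
    (hn : ∀ N, ((S ^ (n N + 1)).card : ℝ) ≤ (1 + ε N) * (S ^ n N).card) :
    IsLeftFolnerSequence fun N => S ^ n N := by
  refine ⟨fun N => ⟨1, Finset.one_mem_pow hS⟩, fun g => ?_⟩
  obtain ⟨r, hr⟩ := hgen g
  have hlim : Tendsto (fun N => 1 - r * ε N) atTop (𝓝 1) := by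
    simpa using (tendsto_const_nhds (x := (1 : ℝ))).sub (hε.const_mul (r : ℝ))
  have hcard : ∀ N, ((g • ((S ^ n N : Finset G) : Set G)) ∩ ((S ^ n N : Finset G) : Set G)).ncard =
      (g • S ^ n N ∩ S ^ n N).card := fun N => by
    rw [← Set.ncard_coe_finset]
    push_cast
    rfl
  have hpos : ∀ N, (0 : ℝ) < (S ^ n N).card := fun N => by
    exact_mod_cast Finset.card_pos.2 ⟨1, Finset.one_mem_pow hS⟩
  refine tendsto_of_tendsto_of_tendsto_of_le_of_le hlim tendsto_const_nhds (fun N => ?_)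
    fun N => ?_
  · simp only [hcard]
    rw [le_div_iff₀ (hpos N)]
    have h1 : ((g • S ^ n N ∩ S ^ n N).card : ℝ) + (g • S ^ n N \ S ^ n N).card =
        (S ^ n N).card := by
      have := Finset.card_inter_add_card_sdiff (g • S ^ n N) (S ^ n N)
      rw [Finset.card_smul_finset] at this
      exact_mod_cast this
    have h2 : ((g • S ^ n N \ S ^ n N).card : ℝ) ≤
        r * ((S ^ (n N + 1)).card - (S ^ n N).card) := by
      have := card_smul_pow_sdiff_le hS (n N) r g hr
      rw [← Nat.cast_sub (Finset.card_le_card (Finset.pow_subset_pow_right hS (Nat.le_succ _)))]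
      exact_mod_cast this
    have h3 := mul_le_mul_of_nonneg_left (hn N) (Nat.cast_nonneg (α := ℝ) r)
    linarith
  · simp only [hcard]
    refine div_le_one_of_le₀ ?_ (hpos N).le
    exact_mod_cast Finset.card_le_card Finset.inter_subset_right

end Folner

/-! ### Comparison of averages -/

section Averages

variable {G : Type*} {u : G → ℝ}

theorem average_nonneg (hu : ∀ g, u g ∈ Set.Icc (0 : ℝ) 1) (F : Finset G) :
    0 ≤ 1 / (F.card : ℝ) * ∑ g ∈ F, u g :=
  mul_nonneg (by positivity) (Finset.sum_nonneg fun g _ => (hu g).1)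

theorem average_le_one (hu : ∀ g, u g ∈ Set.Icc (0 : ℝ) 1) (F : Finset G) :
    1 / (F.card : ℝ) * ∑ g ∈ F, u g ≤ 1 := by
  rw [one_div_mul_eq_div]
  refine div_le_one_of_le₀ ?_ (Nat.cast_nonneg _)
  simpa using Finset.sum_le_card_nsmul F u 1 fun g _ => (hu g).2

theorem average_comp_le {φ : G → G} (hφ : Function.Injective φ) (hu : ∀ g, 0 ≤ u g)
    {E F : Finset G} (hEF : ∀ g ∈ E, φ g ∈ F) (hE : E.Nonempty) (hF : F.Nonempty) {C : ℝ}
    (hC : (F.card : ℝ) ≤ C * E.card) :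
    1 / (E.card : ℝ) * ∑ g ∈ E, u (φ g) ≤ C * (1 / (F.card : ℝ) * ∑ g ∈ F, u g) := by
  classical
  have hE' : (0 : ℝ) < E.card := by exact_mod_cast hE.card_pos
  have hF' : (0 : ℝ) < F.card := by exact_mod_cast hF.card_pos
  have h1 : ∑ g ∈ E, u (φ g) ≤ ∑ g ∈ F, u g := by
    rw [← Finset.sum_image (f := u) hφ.injOn]
    exact Finset.sum_le_sum_of_subset_of_nonneg (Finset.image_subset_iff.2 hEF)
      fun g _ _ => hu g
  have h2 : 1 / (E.card : ℝ) ≤ C * (1 / F.card) := by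
    rw [mul_one_div, div_le_div_iff₀ hE' hF', one_mul]
    exact hC
  rw [← mul_assoc]
  exact mul_le_mul h2 h1 (Finset.sum_nonneg fun g _ => hu _) ((by positivity : (0 : ℝ) ≤ _).trans h2)

end Averages

theorem isAbsolutelyContinuousGroup_of_injective {G : Type*} [Group G] {φ : G → G}
    (hφ : Function.Injective φ) {Φ Ψ : ℕ → Finset G} (hΦ : IsLeftFolnerSequence Φ)
    (hΨ : IsLeftFolnerSequence Ψ) (hmaps : ∀ N, ∀ g ∈ Ψ N, φ g ∈ Φ N) {C : ℝ} (hC0 : 0 < C)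
    (hC : ∀ N, ((Φ N).card : ℝ) ≤ C * (Ψ N).card) : IsAbsolutelyContinuousGroup G φ := by
  -- The factor 2 restores the strict inequality, which passing to the limsup loses.
  refine ⟨Φ, Ψ, hΦ, hΨ, fun ε hε => ⟨ε / (2 * C), by positivity, fun u hu h => ?_⟩⟩
  have hev := eventually_lt_of_limsup_lt h
    (isBoundedUnder_of ⟨1, fun N => average_le_one hu (Φ N)⟩)
  have hle : upperAverage Ψ (fun g => u (φ g)) ≤ ε / 2 := by
    refine limsup_le_of_le (IsBoundedUnder.isCoboundedUnder_le
      (isBoundedUnder_of ⟨0, fun N => average_nonneg (fun g => hu (φ g)) (Ψ N)⟩)) ?_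
    filter_upwards [hev] with N hN
    refine (average_comp_le hφ (fun g => (hu g).1) (hmaps N) (hΨ.nonempty N) (hΦ.nonempty N)
      (hC N)).trans ((mul_le_mul_of_nonneg_left hN.le hC0.le).trans_eq ?_)
    field_simp
  linarith

theorem exists_finset_one_mem_forall_mem_pow (G : Type*) [Group G] [DecidableEq G] [Group.FG G] :
    ∃ S : Finset G, 1 ∈ S ∧ ∀ g : G, ∃ r, g ∈ S ^ r := by
  obtain ⟨S, hS⟩ := (Monoid.fg_def.1 (Group.fg_iff_monoid_fg.1 ‹Group.FG G›))
  refine ⟨insert 1 S, by simp, fun g => ?_⟩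
  obtain ⟨l, hl, rfl⟩ := Submonoid.exists_list_of_mem_closure
    (show g ∈ Submonoid.closure (S : Set G) by rw [hS]; trivial)
  exact ⟨l.length, list_prod_mem_finset_pow l fun s hs => Finset.mem_insert_of_mem (hl s hs)⟩

theorem theorem1p2 (G : Type*) [Group G] [Group.FG G] [Group.IsNilpotent G]
    (hG : IsTorsionFreeGroup G) : IsSquareAbsolutelyContinuous G := by
  classical
  obtain ⟨S, hS, hgen⟩ := exists_finset_one_mem_forall_mem_pow G
  obtain ⟨d, hd⟩ := exists_card_pow_le_of_isNilpotent S
  have hscales := fun N : ℕ => exists_scales (b := fun n => (S ^ n).card)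
    (fun _ _ h => Finset.card_le_card (Finset.pow_subset_pow_right hS h))
    (fun n => Finset.card_pos.2 ⟨1, Finset.one_mem_pow hS⟩) hd (Nat.one_div_pos_of_nat (α := ℝ) (n := N))
  choose n m hnm hn hm hC using hscales
  have hε := tendsto_one_div_add_atTop_nhds_zero_nat (𝕜 := ℝ)
  -- `Φ` uses the larger exponents `m N`, `Ψ` the smaller `n N`.
  refine isAbsolutelyContinuousGroup_of_injective (sq_injective_of_torsionFree_nilpotent hG)
    (isLeftFolnerSequence_pow hS hgen hε hm) (isLeftFolnerSequence_pow hS hgen hε hn)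
    (fun N g hg => ?_) (by positivity) hC
  refine Finset.pow_subset_pow_right hS (hnm N) ?_
  rw [mul_comm, pow_mul]
  exact Finset.pow_mem_pow hg
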